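/- **Setting.** Let $N$ (students), $M$ (colleges) and $F$ (features) be finite sets. An instance consists of a capacity $x_c\ge 1$ and a strict total order $\succ_c$ on $N$ for each college $c\in M$, and, for each student $s\in N$, of utility functions $u_s^f:M\to[0,1]$ $(f\in F)$ and a probability distribution $\mu_s$ on the weight vectors $w\in\mathbb R^F$ with $w^f\ge 0$ and $\sum_f w^f=1$. For a weight vector $w$ write $c\succeq_s^w c'$ if $\sum_f w^fu_s^f(c)\ge\sum_f w^fu_s^f(c')$, and $c\succ_s^w c'$ if the inequality is strict; every college is strictly better for $s$ than being unmatched ($\mathsf{null}$). Below, $\Pr$ and $\mathbb E$ for student $s$ refer to $w_s\sim\mu_s$. **GDA.** Initially nobody is matched and $R_s=\emptyset$ for all $s$, where $R_s$ is the set of colleges that have rejected $s$. As long as some unmatched student $s$ has $R_s\ne M$, do the following round: every unmatched student $s$ with $R_s\ne M$ proposes to the college $\mathsf{Next}(s,R_s,(u_s^f)_f,\mu_s)\notin R_s$; then every college $c$ keeps, among the students it holds and those who just proposed to it, its $x_c$ most preferred ones (all of them if there are at most $x_c$), and rejects the others, who become unmatched and have $c$ added to their sets $R_s$. The final matching is the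 output. **Proposing rules.** For $R\subsetneq M$ and $c\notin R$ let $\tilde q_s(c,R)$ be the vector of the numbers $\Pr[c\succeq_s^{w_s}c']$, $c'\in M\setminus R$, $c'\neq c$, in ascending order. The college $\mathsf{Next}(s,R,(u_s^f)_f,\mu_s)$ is an element $c$ of $M\setminus R$ which, among all elements of $M\setminus R$, - HEUF: maximizes $\mathbb E[\sum_f w_s^fu_s^f(c)]$; - LOCV: has the lexicographically largest comparison vector $\tilde q_s(c,\emptyset)$; - LOICV: has the lexicographically largest comparison vector $\tilde q_s(c,R)$; - HERF: maximizes $\Pr[\,c\succeq_s^{w_s}c'\text{ for all }c'\in M\setminus R,\ c'\ne c\,]$; with any predetermined or random tie-breaking. **Theorem.** GDA with any of the proposing rules LOCV, LOICV, HERF, HEUF is incentive compatible with certainty (IC-C). That is, for every instance, every student $s$ and every misreport $(u_s',\mu_s')$ of her utility functions and distribution (all other data unchanged), if $\pi(s)$ and $\pi'(s)$ are her assignments (a college or $\mathsf{null}$) under her truthful report $(u_s,\mu_s)$ and under the misreport, then $$\Pr_{w_s\sim\mu_s}\bigl[\pi'(s)\succ_s^{w_s}\pi(s)\bigr]\neq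 1 .$$ With random tie-breaking (a random seed selects the tie-breaking, the seeds of the two runs of the algorithm being independent), the probability that $\pi'(s)\succ_s^{w_s}\pi(s)$, taken over both seeds and $w_s\sim\mu_s$, is not $1$ either. -/

import Mathlib

open MeasureTheory

namespace SchoolChoice

/-! School choice with feature-based uncertain preferences: `S` is the set of students, `C` the set
of colleges and `F` the set of features. -/

/-- What a student reports: a utility function `u f : C → [0,1]` for each feature `f`, and a
probability distribution `μ` on the weight vectors, i.e. on the `w : F → ℝ` with `0 ≤ w f` for
all `f` and `∑ f, w f = 1`. -/
structure Report (C F : Type*) [Fintype F] where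
  u : F → C → Set.Icc (0 : ℝ) 1
  μ : ProbabilityMeasure (stdSimplex ℝ F)

/-- An instance of the problem: positive capacities, strict preferences of the colleges over the
students (`pref c s s'` means that `c` prefers `s` to `s'`), and the students' information. -/
structure Instance (S C F : Type*) [Fintype F] where
  cap : C → ℕ
  cap_pos : ∀ c, 0 < cap c
  pref : C → S → S → Prop
  pref_strict : ∀ c, IsStrictTotalOrder S (pref c)
  report : S → Report C F

/-- The instance in which the information of student `s` is replaced by `r`. -/
def Instance.misreport {S C F : Type*} [DecidableEq S] [Fintype F]
    (I : Instance S C F) (s : S) (r : Report C F) : Instance S C F :=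
  { I with report := Function.update I.report s r }

section Reports

variable {C F : Type*} [Fintype C] [DecidableEq C] [Fintype F]

/-- The weighted utility `∑ f, w f * u f c` of college `c`. -/
def Report.util (r : Report C F) (w : stdSimplex ℝ F) (c : C) : ℝ :=
  ∑ f, w.1 f * (r.u f c : ℝ)

/-- The expected utility of `c`, for `w` distributed according to `r.μ`. -/
noncomputable def Report.expUtil (r : Report C F) (c : C) : ℝ :=
  ∫ w, r.util w c ∂(r.μ : Measure (stdSimplex ℝ F))

/-- `Pr[c ⪰ c']`, for `w` distributed according to `r.μ`. -/
noncomputable def Report.prGE (r : Report C F) (c c' : C) : ℝ :=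
  (r.μ : Measure (stdSimplex ℝ F)).real {w | r.util w c' ≤ r.util w c}

/-- The probability that `c` is weakly preferred to all other colleges outside `R`. -/
noncomputable def Report.prTop (r : Report C F) (R : Finset C) (c : C) : ℝ :=
  (r.μ : Measure (stdSimplex ℝ F)).real
    {w | ∀ c', c' ≠ c → c' ∉ R → r.util w c' ≤ r.util w c}

/-- The comparison vector of `c` relative to the colleges outside `R`: the numbers `Pr[c ⪰ c']`
with `c' ∉ R` and `c' ≠ c`, in ascending order. -/
noncomputable def Report.compVec (r : Report C F) (R : Finset C) (c : C) : List ℝ :=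
  (((Finset.univ \ R).erase c).val.map (fun c' => r.prGE c c')).sort (· ≤ ·)

/-- Lexicographic comparison: for some `k` the first `k` entries of `l` and `l'` agree, and the
next entry of `l` is larger than that of `l'`. -/
def LexGT (l l' : List ℝ) : Prop :=
  ∃ (k : ℕ) (h : k < l.length) (h' : k < l'.length), l.take k = l'.take k ∧ l'[k] < l[k]

/-- Strict preference of a student with information `r` over assignments, under the weight vector
`w`; `none` means that she is unmatched, which is worse than any college. -/
def Report.Prefers (r : Report C F) (w : stdSimplex ℝ F) : Option C → Option C → Prop
  | some c', some c => r.util w c < r.util w c'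
  | some _, none => True
  | none, _ => False

end Reports

section Rules

/-- A proposing rule `Next`: the college to which student `s` with information `r` proposes next
when `R` is the set of colleges that have rejected her (only used for `R` not the set of all
colleges). Tie-breaking is part of the rule. -/
abbrev Rule (S C F : Type*) [Fintype F] := S → Finset C → Report C F → C

variable {S C F : Type*} [Fintype C] [DecidableEq C] [Fintype F]

/-- Higher Expected Utility First. -/
def IsHEUF (next : Rule S C F) : Prop :=
  ∀ s R r, R ≠ Finset.univ → next s R r ∉ R ∧
    ∀ c, c ∉ R → r.expUtil c ≤ r.expUtil (next s R r)

/-- Lexicographic Order of Comparison Vectors: `Next` returns a college outside `R` that comes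
first in the lexicographic order of the comparison vectors among all colleges; ties are broken in
any way. -/
def IsLOCV (next : Rule S C F) : Prop :=
  ∀ s R r, R ≠ Finset.univ → next s R r ∉ R ∧
    ∀ c, c ∉ R → ¬ LexGT (r.compVec ∅ c) (r.compVec ∅ (next s R r))

/-- Lexicographic Order of Iterated Comparison Vectors: as before, with the comparison vectors
taken among the colleges outside `R`. -/
def IsLOICV (next : Rule S C F) : Prop :=
  ∀ s R r, R ≠ Finset.univ → next s R r ∉ R ∧
    ∀ c, c ∉ R → ¬ LexGT (r.compVec R c) (r.compVec R (next s R r))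

/-- Higher Expected Ranking First. -/
def IsHERF (next : Rule S C F) : Prop :=
  ∀ s R r, R ≠ Finset.univ → next s R r ∉ R ∧
    ∀ c, c ∉ R → r.prTop R c ≤ r.prTop R (next s R r)

end Rules

section GDA

variable {S C F : Type*} [Fintype S] [Fintype C] [DecidableEq C] [Fintype F]

/-- A state of the deferred acceptance algorithm: the current matching, and for each student the
set of colleges that have rejected her. -/
structure State (S C : Type*) where
  assigned : S → Option C
  rejected : S → Finset C

/-- The initial state: nobody is matched, nobody has been rejected. -/
def State.init (S C : Type*) : State S C := ⟨fun _ => none, fun _ => ∅⟩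

/-- The college for which `s` is a candidate in the current round: the one that holds her or, if
she is unmatched and not yet rejected by all colleges, the one to which she proposes. -/
def State.target (next : Rule S C F) (I : Instance S C F) (σ : State S C) (s : S) : Option C :=
  match σ.assigned s with
  | some c => some c
  | none => if σ.rejected s = Finset.univ then none
      else some (next s (σ.rejected s) (I.report s))

open Classical in
/-- One round: every unmatched student who has not been rejected by all colleges proposes, and then
every college `c` keeps its `cap c` most preferred candidates (all of them if there are at most
`cap c`), namely those to whom it prefers fewer than `cap c` candidates, and rejects the others. -/
noncomputable def State.step (next : Rule S C F) (I : Instance S C F) (σ : State S C) :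
    State S C where
  assigned s :=
    match σ.target next I s with
    | none => none
    | some c =>
      if (Finset.univ.filter fun s' => σ.target next I s' = some c ∧ I.pref c s' s).card < I.cap c
      then some c else none
  rejected s :=
    match σ.target next I s with
    | none => σ.rejected s
    | some c =>
      if (Finset.univ.filter fun s' => σ.target next I s' = some c ∧ I.pref c s' s).card < I.cap c
      then σ.rejected s else insert c (σ.rejected s)

/-- The final state of the generalized deferred acceptance algorithm. Once every unmatched student
has been rejected by all colleges, a round changes nothing; this happens after at most `|S| * |C|`
rounds, see `gdaState_final`. -/
noncomputable def gdaState (next : Rule S C F) (I : Instance S C F) : State S C :=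
  (State.step next I)^[Fintype.card S * Fintype.card C] (State.init S C)

/-- The generalized student-proposing deferred acceptance algorithm with proposing rule `next`;
it returns the matching, `none` meaning unmatched. -/
noncomputable def GDA (next : Rule S C F) (I : Instance S C F) : S → Option C :=
  (gdaState next I).assigned

/-- All colleges to which `s` has proposed so far. -/
def State.proposed (σ : State S C) (s : S) : Finset C :=
  σ.rejected s ∪ (σ.assigned s).toFinset

theorem State.proposed_step (next : Rule S C F) (I : Instance S C F) (σ : State S C)
    (s : S) : (σ.step next I).proposed s = σ.rejected s ∪ (σ.target next I s).toFinset := by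
  unfold State.proposed State.step
  simp only
  cases h : σ.target next I s with
  | none => simp
  | some c =>
    simp only
    split_ifs
    · rfl
    · ext x; simp

/-- The loop has ended: in the state returned, every unmatched student has been rejected by all
colleges. -/
theorem gdaState_final (next : Rule S C F)
    (hnext : ∀ s R r, R ≠ Finset.univ → next s R r ∉ R) (I : Instance S C F) (s : S)
    (hs : (gdaState next I).assigned s = none) :
    (gdaState next I).rejected s = Finset.univ := by
  classical
  have mono : ∀ (σ : State S C) (t : S), σ.proposed t ⊆ (σ.step next I).proposed t := by
    intro σ t
    rw [State.proposed_step]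
    unfold State.proposed State.target
    cases h : σ.assigned t <;> simp
  have grow : ∀ (σ : State S C) (t : S), σ.assigned t = none → σ.rejected t ≠ Finset.univ →
      (σ.proposed t).card < ((σ.step next I).proposed t).card := by
    intro σ t h1 h2
    apply Finset.card_lt_card
    refine (Finset.ssubset_iff_of_subset (mono σ t)).2 ⟨next t (σ.rejected t) (I.report t), ?_, ?_⟩
    · rw [State.proposed_step]
      simp [State.target, h1, h2]
    · simpa [State.proposed, h1] using hnext t _ _ h2
  have key : ∀ n : ℕ,
      (∀ t c, ((State.step next I)^[n] (State.init S C)).assigned t = some c →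
        (Finset.univ.filter fun t' =>
          ((State.step next I)^[n] (State.init S C)).assigned t' = some c ∧
            I.pref c t' t).card < I.cap c) ∧
      ((∀ t, ((State.step next I)^[n] (State.init S C)).assigned t = none →
          ((State.step next I)^[n] (State.init S C)).rejected t = Finset.univ) ∨
        n ≤ ∑ t, (((State.step next I)^[n] (State.init S C)).proposed t).card) := by
    intro n
    induction n with
    | zero => simp [State.init]
    | succ n ih =>
      rw [Function.iterate_succ_apply']
      generalize (State.step next I)^[n] (State.init S C) = σ at ih ⊢
      obtain ⟨hV, hD⟩ := ih
      have hsub : ∀ t c, (σ.step next I).assigned t = some c → σ.target next I t = some c ∧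
          (Finset.univ.filter fun t' => σ.target next I t' = some c ∧ I.pref c t' t).card
            < I.cap c := by
        intro t c h
        simp only [State.step] at h
        cases h' : σ.target next I t with
        | none => simp [h'] at h
        | some d =>
          rw [h'] at h
          simp only at h
          split_ifs at h with h2
          cases h
          exact ⟨rfl, h2⟩
      refine ⟨?_, ?_⟩
      · intro t c h
        refine lt_of_le_of_lt (Finset.card_le_card ?_) (hsub t c h).2
        intro x
        simp only [Finset.mem_filter, Finset.mem_univ, true_and]
        exact fun hx => ⟨(hsub x c hx.1).1, hx.2⟩
      · by_cases hdone : ∀ t, σ.assigned t = none → σ.rejected t = Finset.univ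
        · left
          have htar : ∀ t, σ.target next I t = σ.assigned t := by
            intro t
            unfold State.target
            cases h : σ.assigned t with
            | none => simp [hdone t h]
            | some c => rfl
          intro t h
          cases h' : σ.assigned t with
          | none =>
            simp only [State.step, htar, h']
            exact hdone t h'
          | some c =>
            exfalso
            simp only [State.step, htar, h'] at h
            rw [if_pos (hV t c h')] at h
            cases h
        · right
          have hle := hD.resolve_left hdone
          push Not at hdone
          obtain ⟨t, h1, h2⟩ := hdone
          have := Finset.sum_lt_sum (s := Finset.univ)
            (fun x _ => Finset.card_le_card (mono σ x)) ⟨t, Finset.mem_univ t, grow σ t h1 h2⟩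
          omega
  rcases (key (Fintype.card S * Fintype.card C)).2 with h | h
  · exact h s hs
  · by_contra hR
    have hlt : ((gdaState next I).proposed s).card < Fintype.card C := by
      rw [Finset.card_lt_iff_ne_univ]
      simpa [State.proposed, hs] using hR
    have := Finset.sum_lt_sum (s := Finset.univ)
      (f := fun t => ((gdaState next I).proposed t).card) (g := fun _ => Fintype.card C)
      (fun x _ => Finset.card_le_univ _) ⟨s, Finset.mem_univ s, hlt⟩
    simp only [Finset.sum_const, Finset.card_univ, smul_eq_mul] at this
    unfold gdaState at this
    omega

end GDA

section IncentiveCompatibility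

variable {S C F : Type*} [DecidableEq S] [Fintype F]

/-- Incentive compatibility with certainty of a matching algorithm: there are no instance, student
`s` and misreport `r` such that the assignment of `s` under the misreport is, with probability 1
according to her true information, strictly better than her assignment when she is truthful. -/
def ICC (alg : Instance S C F → S → Option C) : Prop :=
  ∀ (I : Instance S C F) (s : S) (r : Report C F),
    ((I.report s).μ : Measure (stdSimplex ℝ F))
      {w | (I.report s).Prefers w (alg (I.misreport s r) s) (alg I s)} ≠ 1

/-- Incentive compatibility with certainty of a randomized matching algorithm, with seed `t`
distributed according to `ν`: the runs of the algorithm on the truthful report and on the misreport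
use independent seeds, and the probability is over both seeds and the weight vector. -/
def ICCRandom {T : Type*} [MeasurableSpace T] (ν : Measure T)
    (alg : T → Instance S C F → S → Option C) : Prop :=
  ∀ (I : Instance S C F) (s : S) (r : Report C F),
    ((ν.prod ν).prod ((I.report s).μ : Measure (stdSimplex ℝ F)))
      {p | (I.report s).Prefers p.2 (alg p.1.2 (I.misreport s r) s) (alg p.1.1 I s)} ≠ 1

end IncentiveCompatibility

end SchoolChoice

/-!
A student is matched to a college that has not rejected her, and each of the four rules lets her
propose to a college than which no other available one is better with certainty. So it suffices
that no misreport matches `s` to a college that rejects her when she is truthful. This is the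
strategy-proofness of deferred acceptance, where the preferences of a student are replaced by the
order of her proposals.

It follows from the blocking lemma of Gale and Sotomayor: if a matching `τ` gives some students
(the gainers) colleges that have rejected them, then some other student `x` is preferred, by a
college to which she has proposed, to one of the students that it gets under `τ`. Indeed, if there
is no such `x`, then counting the seats at the colleges of the gainers shows that every gainer is
matched at present, although a student who has just become a gainer is unmatched.

In the case at hand `s` is a gainer, so `x` has the same information in both runs, and her proposal
to that college contradicts the choices of the college in the second run.
-/

namespace SchoolChoice

open scoped Finset

section LexGT

theorem LexGT.cons {l l' : List ℝ} (a : ℝ) (h : LexGT l l') : LexGT (a :: l) (a :: l') := by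
  obtain ⟨k, hk, hk', htake, hlt⟩ := h
  exact ⟨k + 1, by simpa using hk, by simpa using hk', by simpa using htake, by simpa using hlt⟩

theorem lexGT_of_count_lt {l l' : List ℝ} {a : ℝ} (hl : l.Pairwise (· ≤ ·))
    (hl' : l'.Pairwise (· ≤ ·)) (ha : ∀ x ∈ l, a ≤ x) (ha' : ∀ x ∈ l', a ≤ x)
    (hlen : l.length = l'.length) (hcount : l.count a < l'.count a) : LexGT l l' := by
  induction l generalizing l' with
  | nil => simp [List.eq_nil_of_length_eq_zero hlen.symm] at hcount
  | cons x l ih =>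
    cases l' with
    | nil => simp at hcount
    | cons y l' =>
      obtain rfl : y = a := by
        refine le_antisymm ?_ (ha' y List.mem_cons_self)
        rcases List.mem_cons.1 (List.count_pos_iff.1 (pos_of_gt hcount)) with h | h
        · exact h.ge
        · exact List.rel_of_pairwise_cons hl' h
      rcases (ha x List.mem_cons_self).eq_or_lt with rfl | hlt
      · exact LexGT.cons y <| ih hl.of_cons hl'.of_cons
          (fun z hz => ha z (List.mem_cons_of_mem _ hz))
          (fun z hz => ha' z (List.mem_cons_of_mem _ hz)) (by simpa using hlen)
          (by simpa using hcount)
      · exact ⟨0, by simp, by simp, by simp, by simpa using hlt⟩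

end LexGT

section Reports

variable {C F : Type*} [Fintype F]

theorem Report.continuous_util (r : Report C F) (c : C) : Continuous fun w => r.util w c := by
  unfold Report.util
  exact continuous_finsetSum _ fun f _ =>
    ((continuous_apply f).comp continuous_subtype_val).mul continuous_const

theorem Report.util_nonneg (r : Report C F) (w : stdSimplex ℝ F) (c : C) : 0 ≤ r.util w c :=
  Finset.sum_nonneg fun f _ => mul_nonneg (w.2.1 f) (r.u f c).2.1

theorem Report.util_le_one (r : Report C F) (w : stdSimplex ℝ F) (c : C) : r.util w c ≤ 1 :=
  (Finset.sum_le_sum fun f _ => mul_le_of_le_one_right (w.2.1 f) (r.u f c).2.2).trans_eq w.2.2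

theorem Report.integrable_util (r : Report C F) (c : C) :
    Integrable (fun w => r.util w c) (r.μ : Measure (stdSimplex ℝ F)) :=
  Integrable.of_bound (C := 1) (r.continuous_util c).aestronglyMeasurable <| .of_forall fun w => by
    simpa only [Real.norm_of_nonneg (r.util_nonneg w c)] using r.util_le_one w c

theorem Report.measurableSet_prefers (r : Report C F) (a b : Option C) :
    MeasurableSet {w | r.Prefers w a b} :=
  match a, b with
  | none, _ => MeasurableSet.const False
  | some _, none => MeasurableSet.const True
  | some a, some b =>
    measurableSet_lt (r.continuous_util b).measurable (r.continuous_util a).measurable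

/-- A student with information `r` strictly prefers `c'` to `c` with probability 1. -/
def Report.CertainlyPrefers (r : Report C F) (c' c : C) : Prop :=
  ∀ᵐ w ∂(r.μ : Measure (stdSimplex ℝ F)), r.util w c < r.util w c'

theorem Report.certainlyPrefers_iff_measure_eq_one {r : Report C F} {c' c : C} :
    r.CertainlyPrefers c' c ↔
      (r.μ : Measure (stdSimplex ℝ F)) {w | r.Prefers w (some c') (some c)} = 1 :=
  mem_ae_iff_prob_eq_one (r.measurableSet_prefers (some c') (some c))

namespace Report.CertainlyPrefers

variable {r : Report C F} {c c' : C}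

theorem expUtil_lt (h : r.CertainlyPrefers c' c) : r.expUtil c < r.expUtil c' := by
  have hle : (fun w => r.util w c) ≤ᵐ[(r.μ : Measure (stdSimplex ℝ F))] fun w => r.util w c' :=
    h.mono fun _ => le_of_lt
  refine (integral_mono_ae (r.integrable_util c) (r.integrable_util c') hle).lt_of_ne fun heq => ?_
  have hae := (integral_eq_iff_of_ae_le (r.integrable_util c) (r.integrable_util c') hle).1 heq
  obtain ⟨w, hlt, heq⟩ := (h.and hae).exists
  exact hlt.ne heq

theorem prGE_eq_zero (h : r.CertainlyPrefers c' c) : r.prGE c c' = 0 := by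
  rw [Report.prGE, measureReal_eq_zero_iff, measure_eq_zero_iff_ae_notMem]
  exact h.mono fun _ => not_le_of_gt

theorem prGE_eq_one (h : r.CertainlyPrefers c' c) : r.prGE c' c = 1 := by
  rw [Report.prGE, measureReal_congr (Filter.eventuallyEq_univ.2 (h.mono fun _ => le_of_lt)),
    probReal_univ]

theorem prGE_le (h : r.CertainlyPrefers c' c) (d : C) : r.prGE c d ≤ r.prGE c' d :=
  ENNReal.toReal_mono (measure_ne_top _ _) <| measure_mono_ae <|
    h.mono fun _ hlt hd => le_trans hd hlt.le

theorem prTop_eq_zero {R : Finset C} (hc' : c' ∉ R) (h : r.CertainlyPrefers c' c) :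
    r.prTop R c = 0 := by
  rw [Report.prTop, measureReal_eq_zero_iff, measure_eq_zero_iff_ae_notMem]
  filter_upwards [h] with w hlt htop
  exact (htop c' (by rintro rfl; exact hlt.false) hc').not_gt hlt

end Report.CertainlyPrefers

theorem Report.exists_prTop_pos [Fintype C] (r : Report C F) {R : Finset C}
    (hR : R ≠ Finset.univ) : ∃ c ∉ R, 0 < r.prTop R c := by
  classical
  let top (c : C) : Set (stdSimplex ℝ F) := {w | ∀ c', c' ≠ c → c' ∉ R → r.util w c' ≤ r.util w c}
  have hcover : ⋃ c : {c // c ∉ R}, top c = Set.univ := by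
    refine Set.eq_univ_of_forall fun w => Set.mem_iUnion.2 ?_
    obtain ⟨c, hc, hmax⟩ := Finset.exists_max_image Rᶜ (r.util w)
      (Finset.nonempty_iff_ne_empty.2 fun h => hR ((Finset.compl_eq_empty_iff R).1 h))
    exact ⟨⟨c, Finset.mem_compl.1 hc⟩, fun c' _ hc' => hmax c' (Finset.mem_compl.2 hc')⟩
  obtain ⟨c, hpos⟩ := exists_measure_pos_of_not_measure_iUnion_null
    (μ := (r.μ : Measure (stdSimplex ℝ F))) (s := fun c : {c // c ∉ R} => top c)
    (by simp [hcover])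
  exact ⟨c, c.2, ENNReal.toReal_pos hpos.ne' (measure_ne_top _ _)⟩

variable [Fintype C] [DecidableEq C]

theorem Report.compVec_pairwise_le (r : Report C F) (R : Finset C) (c : C) :
    (r.compVec R c).Pairwise (· ≤ ·) :=
  Multiset.pairwise_sort _ _

theorem Report.nonneg_of_mem_compVec {r : Report C F} {R : Finset C} {c : C} {x : ℝ}
    (hx : x ∈ r.compVec R c) : 0 ≤ x := by
  obtain ⟨d, -, rfl⟩ := Multiset.mem_map.1 ((Multiset.mem_sort _).1 hx)
  exact measureReal_nonneg

theorem Report.length_compVec (r : Report C F) {R : Finset C} {c : C} (hc : c ∉ R) :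
    (r.compVec R c).length = #(Finset.univ \ R) - 1 := by
  rw [Report.compVec, Multiset.length_sort, Multiset.card_map, Finset.card_val,
    Finset.card_erase_of_mem (by simpa using hc)]

theorem Report.count_compVec (r : Report C F) (R : Finset C) (c : C) (x : ℝ) :
    (r.compVec R c).count x = #{d ∈ (Finset.univ \ R).erase c | x = r.prGE c d} := by
  rw [← Multiset.coe_count, Report.compVec, Multiset.sort_eq, Multiset.count_map]
  rfl

theorem Report.CertainlyPrefers.lexGT_compVec {r : Report C F} {R : Finset C} {c c' : C}
    (hc : c ∉ R) (hc' : c' ∉ R) (h : r.CertainlyPrefers c' c) :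
    LexGT (r.compVec R c') (r.compVec R c) := by
  -- Both vectors start with their zeros, and that of `c` has more: also `Pr[c ⪰ c'] = 0`.
  refine lexGT_of_count_lt (a := 0) (r.compVec_pairwise_le R c') (r.compVec_pairwise_le R c)
    (fun _ => nonneg_of_mem_compVec) (fun _ => nonneg_of_mem_compVec)
    (by rw [r.length_compVec hc, r.length_compVec hc']) ?_
  have hne : c' ≠ c := by
    rintro rfl
    exact zero_ne_one (h.prGE_eq_zero.symm.trans h.prGE_eq_one)
  rw [r.count_compVec, r.count_compVec]
  refine Finset.card_lt_card (Finset.ssubset_iff_of_subset (fun d hd => ?_) |>.2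
    ⟨c', by simp [hne, hc', h.prGE_eq_zero], by simp⟩)
  obtain ⟨hd, hzero⟩ := Finset.mem_filter.1 hd
  refine Finset.mem_filter.2 ⟨Finset.mem_erase.2 ⟨?_, Finset.mem_of_mem_erase hd⟩,
    le_antisymm measureReal_nonneg (hzero ▸ h.prGE_le d)⟩
  rintro rfl
  exact zero_ne_one (hzero.trans h.prGE_eq_one)

end Reports

section Rules

variable {S C F : Type*} [Fintype C] [Fintype F]

/-- A rule is safe if it proposes to a college that has not rejected the student, and to which she
prefers no other such college with certainty. -/
def IsSafe (next : Rule S C F) : Prop :=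
  ∀ s R r, R ≠ Finset.univ → next s R r ∉ R ∧ ∀ c, c ∉ R → ¬ r.CertainlyPrefers c (next s R r)

variable {next : Rule S C F}

theorem IsHEUF.isSafe (h : IsHEUF next) : IsSafe next := fun s R r hR =>
  ⟨(h s R r hR).1, fun c hc hpref => ((h s R r hR).2 c hc).not_gt hpref.expUtil_lt⟩

theorem IsHERF.isSafe (h : IsHERF next) : IsSafe next := fun s R r hR => by
  refine ⟨(h s R r hR).1, fun c hc hpref => ?_⟩
  obtain ⟨d, hd, hpos⟩ := r.exists_prTop_pos hR
  exact (hpos.trans_le ((h s R r hR).2 d hd)).ne' (hpref.prTop_eq_zero hc)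

theorem IsLOCV.isSafe [DecidableEq C] (h : IsLOCV next) : IsSafe next := fun s R r hR =>
  ⟨(h s R r hR).1, fun c hc hpref => (h s R r hR).2 c hc
    (hpref.lexGT_compVec (Finset.notMem_empty _) (Finset.notMem_empty _))⟩

theorem IsLOICV.isSafe [DecidableEq C] (h : IsLOICV next) : IsSafe next := fun s R r hR =>
  ⟨(h s R r hR).1, fun c hc hpref => (h s R r hR).2 c hc
    (hpref.lexGT_compVec (h s R r hR).1 hc)⟩

end Rules

section Topmost

variable {α : Type*}

theorem exists_mem_forall_not_rel (p : α → α → Prop) [IsStrictOrder α p] {A : Finset α}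
    (hA : A.Nonempty) : ∃ x ∈ A, ∀ y ∈ A, ¬ p y x := by
  let := partialOrderOfSO p
  obtain ⟨x, hx⟩ := A.exists_minimal hA
  exact ⟨x, hx.prop, fun y hy hyx => hx.not_lt hy hyx⟩

open Classical in
/-- The members of `A` to whom fewer than `k` members are preferred, where `p x y` means that `x`
is preferred to `y`. This is the choice that a college of capacity `k` makes from `A`. -/
noncomputable def topmost (p : α → α → Prop) (k : ℕ) (A : Finset α) : Finset α :=
  {x ∈ A | #{y ∈ A | p y x} < k}

variable (p : α → α → Prop) [IsStrictTotalOrder α p] {k : ℕ} {A : Finset α}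

theorem card_topmost_le : #(topmost p k A) ≤ k := by
  classical
  rcases (topmost p k A).eq_empty_or_nonempty with h | h
  · simp [h]
  obtain ⟨x, hx, hlast⟩ := exists_mem_forall_not_rel (Function.swap p) h
  have hsub : (topmost p k A).erase x ⊆ {y ∈ A | p y x} := fun y hy => by
    obtain ⟨hyx, hy⟩ := Finset.mem_erase.1 hy
    exact Finset.mem_filter.2 ⟨Finset.filter_subset _ _ hy,
      ((trichotomous_of p y x).resolve_right fun h => h.elim hyx (hlast y hy))⟩
  have hrank : #{y ∈ A | p y x} < k := (Finset.mem_filter.1 hx).2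
  have := Finset.card_le_card hsub
  rw [Finset.card_erase_of_mem hx] at this
  omega

open Classical in
theorem le_card_filter_topmost {t : α} (ht : k ≤ #{y ∈ A | p y t}) :
    k ≤ #{x ∈ topmost p k A | p x t} := by
  by_contra! hlt
  obtain ⟨y, hy, hfirst⟩ := exists_mem_forall_not_rel p
    (Finset.sdiff_nonempty_of_card_lt_card (hlt.trans_le ht))
  obtain ⟨hyt, hytop⟩ := Finset.mem_sdiff.1 hy
  obtain ⟨hyA, hyt⟩ := Finset.mem_filter.1 hyt
  have hnot : y ∉ topmost p k A := fun h => hytop (Finset.mem_filter.2 ⟨h, hyt⟩)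
  refine hnot (Finset.mem_filter.2 ⟨hyA, (Finset.card_le_card fun z hz => ?_).trans_lt hlt⟩)
  obtain ⟨hzA, hzy⟩ := Finset.mem_filter.1 hz
  by_contra hztop
  exact hfirst z (Finset.mem_sdiff.2
    ⟨Finset.mem_filter.2 ⟨hzA, _root_.trans hzy hyt⟩, hztop⟩) hzy

end Topmost

section Proposals

variable {C : Type*} [DecidableEq C]

/-- The set of the first `k` colleges to which a student proposes if, having been rejected by the
colleges in `R`, she proposes to `f R`. -/
def proposalChain (f : Finset C → C) (k : ℕ) : Finset C :=
  (fun R => insert (f R) R)^[k] ∅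

theorem proposalChain_succ (f : Finset C → C) (k : ℕ) :
    proposalChain f (k + 1) = insert (f (proposalChain f k)) (proposalChain f k) :=
  Function.iterate_succ_apply' _ _ _

theorem proposalChain_mono (f : Finset C → C) : Monotone (proposalChain f) :=
  monotone_nat_of_le_succ fun k => by
    rw [proposalChain_succ]
    exact Finset.subset_insert _ _

theorem apply_proposalChain_mem (f : Finset C → C) {j k : ℕ} (h : j < k) :
    f (proposalChain f j) ∈ proposalChain f k :=
  proposalChain_mono f h (by rw [proposalChain_succ]; exact Finset.mem_insert_self _ _)

end Proposals

section Step

variable {S C F : Type*} [Fintype C] [DecidableEq C] [Fintype F]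
  {next : Rule S C F} {I : Instance S C F} {σ : State S C} {t : S} {c : C}

theorem State.target_eq_of_assigned (h : σ.assigned t = some c) : σ.target next I t = some c := by
  simp [State.target, h]

variable [Fintype S]

open Classical in
theorem State.step_assigned_eq_some :
    (σ.step next I).assigned t = some c ↔ σ.target next I t = some c ∧
      #{x | σ.target next I x = some c ∧ I.pref c x t} < I.cap c := by
  cases h : σ.target next I t with
  | none => simp [State.step, h]
  | some d =>
    simp only [State.step, h, ite_eq_iff, reduceCtorEq, and_false, or_false, Option.some.injEq]
    rw [and_comm]
    refine and_congr_right ?_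
    rintro rfl
    rfl

open Classical in
theorem State.mem_step_rejected :
    c ∈ (σ.step next I).rejected t ↔ c ∈ σ.rejected t ∨ σ.target next I t = some c ∧
      I.cap c ≤ #{x | σ.target next I x = some c ∧ I.pref c x t} := by
  cases h : σ.target next I t with
  | none => simp [State.step, h]
  | some d =>
    simp only [State.step, h, Option.some.injEq, ← not_lt]
    split_ifs with hd
    · refine ⟨Or.inl, fun hc => hc.resolve_right ?_⟩
      rintro ⟨rfl, hc⟩
      exact hc hd
    · rw [Finset.mem_insert, or_comm, eq_comm]
      refine or_congr_right ⟨?_, And.left⟩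
      rintro rfl
      exact ⟨rfl, hd⟩

theorem State.rejected_subset_step : σ.rejected t ⊆ (σ.step next I).rejected t :=
  fun _ hc => State.mem_step_rejected.2 (Or.inl hc)

theorem State.proposed_subset_step : σ.proposed t ⊆ (σ.step next I).proposed t := by
  rw [State.proposed_step]
  refine Finset.union_subset_union_right fun c hc => ?_
  rw [Option.mem_toFinset] at hc ⊢
  exact State.target_eq_of_assigned hc

theorem State.mem_step_rejected_of_target (h : σ.target next I t = some c)
    (hc : (σ.step next I).assigned t ≠ some c) : c ∈ (σ.step next I).rejected t := by
  classical
  exact State.mem_step_rejected.2 <| Or.inr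
    ⟨h, not_lt.1 fun hlt => hc (State.step_assigned_eq_some.2 ⟨h, hlt⟩)⟩

theorem State.step_rejected_of_assigned (h : (σ.step next I).assigned t = some c) :
    (σ.step next I).rejected t = σ.rejected t := by
  classical
  obtain ⟨htarget, hlt⟩ := State.step_assigned_eq_some.1 h
  ext d
  refine State.mem_step_rejected.trans (or_iff_left ?_)
  rintro ⟨hd, hle⟩
  obtain rfl : c = d := Option.some.inj (htarget.symm.trans hd)
  exact hlt.not_ge hle

theorem State.step_rejected_eq_insert (h : σ.target next I t = some c)
    (hc : (σ.step next I).assigned t ≠ some c) :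
    (σ.step next I).rejected t = insert c (σ.rejected t) := by
  ext d
  rw [Finset.mem_insert, or_comm]
  refine ⟨fun hd => ?_, ?_⟩
  · exact (State.mem_step_rejected.1 hd).imp_right fun hd => Option.some.inj (hd.1.symm.trans h)
  · rintro (hd | rfl)
    · exact State.rejected_subset_step hd
    · exact State.mem_step_rejected_of_target h hc

open Classical in
theorem State.filter_step_assigned :
    ({x | (σ.step next I).assigned x = some c} : Finset S) =
      topmost (I.pref c) (I.cap c) {x | σ.target next I x = some c} := by
  ext x
  simp only [topmost, State.step_assigned_eq_some, Finset.mem_filter,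
    Finset.filter_filter]

end Step

section StudentInvariant

variable {S C F : Type*} [Fintype C] [DecidableEq C] [Fintype F]

/-- The part of the invariant of deferred acceptance that concerns the students: each of them
follows the order of proposals that is determined by the rule and her information. -/
structure State.StudentInvariant (next : Rule S C F) (I : Instance S C F) (σ : State S C) :
    Prop where
  exists_rejected_eq : ∀ t, ∃ k, σ.rejected t = proposalChain (fun R => next t R (I.report t)) k
  rejected_ne_univ : ∀ t c, σ.assigned t = some c → σ.rejected t ≠ Finset.univ
  assigned_eq_next : ∀ t c, σ.assigned t = some c → c = next t (σ.rejected t) (I.report t)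

variable {next : Rule S C F} {I : Instance S C F} {σ : State S C}

theorem State.studentInvariant_init (next : Rule S C F) (I : Instance S C F) :
    (State.init S C).StudentInvariant next I where
  exists_rejected_eq _ := ⟨0, rfl⟩
  rejected_ne_univ _ _ h := nomatch h
  assigned_eq_next _ _ h := nomatch h

namespace State.StudentInvariant

theorem of_target (h : σ.StudentInvariant next I) {t : S} {c : C}
    (hc : σ.target next I t = some c) :
    σ.rejected t ≠ Finset.univ ∧ c = next t (σ.rejected t) (I.report t) := by
  unfold State.target at hc
  split at hc
  case h_1 d hd =>
    cases hc
    exact ⟨h.rejected_ne_univ t c hd, h.assigned_eq_next t c hd⟩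
  case h_2 =>
    split_ifs at hc with hR
    cases hc
    exact ⟨hR, rfl⟩

theorem step [Fintype S] (h : σ.StudentInvariant next I) :
    (σ.step next I).StudentInvariant next I where
  exists_rejected_eq t := by
    obtain ⟨k, hk⟩ := h.exists_rejected_eq t
    cases htarget : σ.target next I t with
    | none => exact ⟨k, by simpa only [State.step, htarget] using hk⟩
    | some c =>
      by_cases hc : (σ.step next I).assigned t = some c
      · exact ⟨k, (State.step_rejected_of_assigned hc).trans hk⟩
      · refine ⟨k + 1, ?_⟩
        rw [State.step_rejected_eq_insert htarget hc, proposalChain_succ, ← hk,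
          ← (h.of_target htarget).2]
  rejected_ne_univ t c hc := by
    rw [State.step_rejected_of_assigned hc]
    exact (h.of_target (State.step_assigned_eq_some.1 hc).1).1
  assigned_eq_next t c hc := by
    rw [State.step_rejected_of_assigned hc]
    exact (h.of_target (State.step_assigned_eq_some.1 hc).1).2

/-- The proposals of `x` in both runs follow the same order. As `e` has not rejected her in the
first run, she has got at least as far in the second one. -/
theorem mem_rejected {J : Instance S C F} {τ : State S C}
    (hσ : σ.StudentInvariant next I) (hτ : τ.StudentInvariant next J) {x : S}
    (hrep : J.report x = I.report x) {d e : C} (hd : d ∈ σ.proposed x)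
    (he : τ.assigned x = some e) (hne : d ≠ e) (heσ : e ∉ σ.rejected x) : d ∈ τ.rejected x := by
  obtain ⟨j, hj⟩ := hσ.exists_rejected_eq x
  obtain ⟨k, hk⟩ := hτ.exists_rejected_eq x
  have henext := hτ.assigned_eq_next x e he
  rw [hrep] at hk henext
  rw [hk] at henext ⊢
  rw [hj] at heσ
  have hjk : j ≤ k := by
    by_contra! hkj
    exact heσ (henext ▸ apply_proposalChain_mem _ hkj)
  rcases Finset.mem_union.1 hd with hd | hd
  · rw [hj] at hd
    exact proposalChain_mono _ hjk hd
  · have hdnext := hσ.assigned_eq_next x d (Option.mem_toFinset.1 hd)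
    rw [hj] at hdnext
    rcases hjk.lt_or_eq with hjk | rfl
    · exact hdnext ▸ apply_proposalChain_mem _ hjk
    · exact absurd (hdnext.trans henext.symm) hne

end State.StudentInvariant

theorem studentInvariant_gdaState [Fintype S] (next : Rule S C F) (I : Instance S C F) :
    (gdaState next I).StudentInvariant next I :=
  Function.Iterate.rec (State.StudentInvariant next I) (State.studentInvariant_init next I)
    (fun _ h => h.step) _

end StudentInvariant

section CollegeInvariant

variable {S C F : Type*} [Fintype S] [DecidableEq C] [Fintype F]

open Classical in
/-- The part of the invariant of deferred acceptance that concerns the colleges: they respect their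
capacities, and a college that has rejected a student is full of students whom it prefers to her. -/
structure State.CollegeInvariant (I : Instance S C F) (σ : State S C) : Prop where
  card_le_cap : ∀ c, #{x | σ.assigned x = some c} ≤ I.cap c
  cap_le_card : ∀ t c, c ∈ σ.rejected t → I.cap c ≤ #{x | σ.assigned x = some c ∧ I.pref c x t}

variable {I : Instance S C F} {σ : State S C}

theorem State.collegeInvariant_init (I : Instance S C F) :
    (State.init S C).CollegeInvariant I where
  card_le_cap c := by simp [State.init]
  cap_le_card _ _ h := absurd h (Finset.notMem_empty _)

theorem State.CollegeInvariant.pref_of_rejected (h : σ.CollegeInvariant I) {t x : S} {c : C}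
    (ht : c ∈ σ.rejected t) (hx : σ.assigned x = some c) : I.pref c x t := by
  classical
  have heq := Finset.eq_of_subset_of_card_le
    (Finset.monotone_filter_right Finset.univ fun y _ hy => hy.1)
    ((h.card_le_cap c).trans (h.cap_le_card t c ht))
  have hmem : x ∈ Finset.univ.filter fun y => σ.assigned y = some c := by simpa using hx
  rw [← heq] at hmem
  exact (Finset.mem_filter.1 hmem).2.2

variable [Fintype C] {next : Rule S C F}

namespace State.CollegeInvariant

theorem step (h : σ.CollegeInvariant I) : (σ.step next I).CollegeInvariant I where
  card_le_cap c := by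
    have := I.pref_strict c
    rw [State.filter_step_assigned]
    exact card_topmost_le _
  cap_le_card t c hc := by
    classical
    have := I.pref_strict c
    have htarget : I.cap c ≤ #{x | σ.target next I x = some c ∧ I.pref c x t} := by
      rcases State.mem_step_rejected.1 hc with hc | ⟨-, hc⟩
      · exact (h.cap_le_card t c hc).trans <| Finset.card_le_card <|
          Finset.monotone_filter_right _ fun x _ => And.imp_left State.target_eq_of_assigned
      · exact hc
    rw [← Finset.filter_filter] at htarget ⊢
    rw [State.filter_step_assigned]
    exact le_card_filter_topmost _ htarget

end State.CollegeInvariant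

theorem collegeInvariant_gdaState (next : Rule S C F) (I : Instance S C F) :
    (gdaState next I).CollegeInvariant I :=
  Function.Iterate.rec (State.CollegeInvariant I) (State.collegeInvariant_init I)
    (fun _ h => h.step) _

end CollegeInvariant

section BlockingLemma

theorem apply_mem_image_of_card_fiber_le {α β : Type*} [DecidableEq β] {W : Finset α} {f g : α → β}
    (h : ∀ x ∈ W, #{y ∈ W | f y = f x} ≤ #{y ∈ W | g y = f x}) {x : α} (hx : x ∈ W) :
    g x ∈ W.image f := by
  have hcard : #W ≤ #{y ∈ W | g y ∈ W.image f} := calc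
    #W = ∑ b ∈ W.image f, #{y ∈ W | f y = b} := Finset.card_eq_sum_card_image f W
    _ ≤ ∑ b ∈ W.image f, #{y ∈ W | g y = b} := Finset.sum_le_sum fun b hb => by
      obtain ⟨z, hz, rfl⟩ := Finset.mem_image.1 hb
      exact h z hz
    _ = #{y ∈ W | g y ∈ W.image f} := Finset.sum_card_fiberwise_eq_card_filter _ _ _
  exact Finset.card_filter_eq_iff.1 (hcard.antisymm' (Finset.card_filter_le _ _)) x hx

variable {S C F : Type*} [Fintype S] [DecidableEq C]

open Classical in
/-- The students who get under `τ` a college that has rejected them in the state `σ`. -/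
noncomputable def State.gainers (σ : State S C) (τ : S → Option C) : Finset S :=
  {t | ∃ c, τ t = some c ∧ c ∈ σ.rejected t}

variable {σ : State S C} {τ : S → Option C} {t : S} {c : C}

theorem State.mem_gainers : t ∈ σ.gainers τ ↔ ∃ c, τ t = some c ∧ c ∈ σ.rejected t := by
  simp [State.gainers]

theorem State.mem_gainers_of_eq_some (h : τ t = some c) :
    t ∈ σ.gainers τ ↔ c ∈ σ.rejected t := by
  simp [State.mem_gainers, h]

variable [Fintype F]

/-- The conclusion of the blocking lemma: some student `x` who is not a gainer is preferred by a
college to which she has proposed to a student `t` matched to it under `τ`, while she is not. -/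
def State.Blocked (I : Instance S C F) (σ : State S C) (τ : S → Option C) : Prop :=
  ∃ x t c, x ∉ σ.gainers τ ∧ τ t = some c ∧ c ∈ σ.proposed x ∧ I.pref c x t ∧ τ x ≠ some c

variable {next : Rule S C F} {I : Instance S C F}

namespace State.CollegeInvariant

/-- The students whom `c` holds and who are not gainers are matched to `c` under `τ` as well, for
otherwise they would block. -/
theorem card_filter_gainers_le (h : σ.CollegeInvariant I)
    (hτ : ∀ c, #{x | τ x = some c} ≤ I.cap c) (hblocked : ¬ σ.Blocked I τ)
    (ht : t ∈ σ.gainers τ) (htc : τ t = some c) :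
    #{x ∈ σ.gainers τ | τ x = some c} ≤ #{x ∈ σ.gainers τ | σ.assigned x = some c} := by
  classical
  have hrej : c ∈ σ.rejected t := (State.mem_gainers_of_eq_some htc).1 ht
  have hfull : #{x | τ x = some c} ≤ #{x | σ.assigned x = some c} :=
    (hτ c).trans <| (h.cap_le_card t c hrej).trans <| Finset.card_le_card <|
      Finset.monotone_filter_right _ fun _ _ => And.left
  have hothers : #{x | x ∉ σ.gainers τ ∧ σ.assigned x = some c} ≤
      #{x | x ∉ σ.gainers τ ∧ τ x = some c} := by
    refine Finset.card_le_card <| Finset.monotone_filter_right _ fun x _ hx => ⟨hx.1, ?_⟩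
    by_contra hne
    have hxc : c ∈ σ.proposed x := Finset.mem_union_right _ (Option.mem_toFinset.2 hx.2)
    exact hblocked ⟨x, t, c, hx.1, htc, hxc, h.pref_of_rejected hrej hx.2, hne⟩
  have hsplit (f : S → Option C) : #{x ∈ σ.gainers τ | f x = some c} +
      #{x | x ∉ σ.gainers τ ∧ f x = some c} = #{x | f x = some c} := by
    rw [← Finset.card_filter_add_card_filter_not (s := {x | f x = some c}) (· ∈ σ.gainers τ),
      Finset.filter_filter, Finset.filter_filter]
    congr 2
    · ext
      simp [and_comm]
    · ext
      simp [and_comm]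
  have hsplitτ := hsplit τ
  have hsplitσ := hsplit σ.assigned
  lia

theorem exists_assigned_eq_of_mem_gainers (h : σ.CollegeInvariant I)
    (hτ : ∀ c, #{x | τ x = some c} ≤ I.cap c) (hblocked : ¬ σ.Blocked I τ)
    (ht : t ∈ σ.gainers τ) : ∃ c, σ.assigned t = some c := by
  have himage : σ.assigned t ∈ (σ.gainers τ).image τ :=
    apply_mem_image_of_card_fiber_le (fun x hx => by
      obtain ⟨c, hc, -⟩ := State.mem_gainers.1 hx
      rw [hc]
      exact h.card_filter_gainers_le hτ hblocked hx hc) ht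
  obtain ⟨t₀, ht₀, heq⟩ := Finset.mem_image.1 himage
  obtain ⟨c, hc, -⟩ := State.mem_gainers.1 ht₀
  exact ⟨c, heq.symm.trans hc⟩

variable [Fintype C]

theorem gainers_step_of_not_blocked (h : σ.CollegeInvariant I)
    (hτ : ∀ c, #{x | τ x = some c} ≤ I.cap c) (hblocked : ¬ (σ.step next I).Blocked I τ) :
    (σ.step next I).gainers τ = σ.gainers τ := by
  ext x
  refine ⟨fun hx => ?_, fun hx => ?_⟩
  · obtain ⟨c, hc⟩ := h.step.exists_assigned_eq_of_mem_gainers hτ hblocked hx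
    simpa only [State.mem_gainers, State.step_rejected_of_assigned hc] using hx
  · obtain ⟨c, hc, hrej⟩ := State.mem_gainers.1 hx
    exact State.mem_gainers.2 ⟨c, hc, State.rejected_subset_step hrej⟩

theorem blocked_step (h : σ.CollegeInvariant I) (hτ : ∀ c, #{x | τ x = some c} ≤ I.cap c)
    (hσ : (σ.gainers τ).Nonempty → σ.Blocked I τ) (hne : ((σ.step next I).gainers τ).Nonempty) :
    (σ.step next I).Blocked I τ := by
  by_contra hblocked
  have hgainers : (σ.step next I).gainers τ = σ.gainers τ :=
    h.gainers_step_of_not_blocked hτ hblocked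
  obtain ⟨x, t, c, hx, ht, hc, hpref, hxc⟩ := hσ (hgainers ▸ hne)
  exact hblocked ⟨x, t, c, hgainers ▸ hx, ht, State.proposed_subset_step hc, hpref, hxc⟩

end State.CollegeInvariant

theorem State.not_nonempty_gainers_init (τ : S → Option C) :
    ¬ ((State.init S C).gainers τ).Nonempty := by
  simp [State.gainers, State.init]

theorem blocked_gdaState [Fintype C] (next : Rule S C F) (I : Instance S C F)
    (hτ : ∀ c, #{x | τ x = some c} ≤ I.cap c) (hne : ((gdaState next I).gainers τ).Nonempty) :
    (gdaState next I).Blocked I τ := by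
  have hinv := Function.Iterate.rec
    (fun σ : State S C => σ.CollegeInvariant I ∧ ((σ.gainers τ).Nonempty → σ.Blocked I τ))
    ⟨State.collegeInvariant_init I, fun h => absurd h (State.not_nonempty_gainers_init τ)⟩
    (fun _ h => ⟨h.1.step (next := next), h.1.blocked_step hτ h.2⟩)
    (Fintype.card S * Fintype.card C)
  exact hinv.2 hne

end BlockingLemma

section IncentiveCompatibility

variable {S C F : Type*} [Fintype S] [Fintype C] [DecidableEq C] [Fintype F] {next : Rule S C F}

theorem mem_rejected_gdaState_of_mem_proposed (hnext : ∀ s R r, R ≠ Finset.univ → next s R r ∉ R)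
    {I J : Instance S C F} {x : S} (hrep : J.report x = I.report x)
    (hx : x ∉ (gdaState next I).gainers (GDA next J)) {c : C}
    (hc : c ∈ (gdaState next I).proposed x) (hxc : GDA next J x ≠ some c) :
    c ∈ (gdaState next J).rejected x := by
  cases hJx : GDA next J x with
  | none => exact gdaState_final next hnext J x hJx ▸ Finset.mem_univ c
  | some e =>
    refine (studentInvariant_gdaState next I).mem_rejected (studentInvariant_gdaState next J) hrep
      hc hJx (fun hce => hxc (hce ▸ hJx)) ?_
    exact mt (State.mem_gainers_of_eq_some hJx).2 hx

theorem notMem_rejected_of_GDA_eq_some (hnext : ∀ s R r, R ≠ Finset.univ → next s R r ∉ R)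
    {I J : Instance S C F} (hcap : J.cap = I.cap) (hpref : J.pref = I.pref) {s : S}
    (hrep : ∀ x, x ≠ s → J.report x = I.report x) {c : C} (hc : GDA next J s = some c) :
    c ∉ (gdaState next I).rejected s := by
  intro hrej
  have hs : s ∈ (gdaState next I).gainers (GDA next J) := State.mem_gainers.2 ⟨c, hc, hrej⟩
  have hJ := collegeInvariant_gdaState next J
  obtain ⟨x, t, d, hx, ht, hd, hxt, hxd⟩ :=
    blocked_gdaState next I (fun d => hcap ▸ hJ.card_le_cap d) ⟨s, hs⟩
  have hrejx : d ∈ (gdaState next J).rejected x :=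
    mem_rejected_gdaState_of_mem_proposed hnext (hrep x fun h => hx (h ▸ hs)) hx hd hxd
  have htx : I.pref d t x := hpref ▸ hJ.pref_of_rejected hrejx ht
  have := I.pref_strict d
  exact asymm_of (I.pref d) htx hxt

theorem IsSafe.icc [DecidableEq S] (h : IsSafe next) : ICC (GDA next) := by
  intro I s r hprob
  have hnext : ∀ s R r, R ≠ Finset.univ → next s R r ∉ R := fun s R r hR => (h s R r hR).1
  cases hmis : GDA next (I.misreport s r) s with
  | none => simp [hmis, Report.Prefers] at hprob
  | some c' =>
    have hc' : c' ∉ (gdaState next I).rejected s :=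
      notMem_rejected_of_GDA_eq_some (I := I) (J := I.misreport s r) hnext rfl rfl
        (fun x hx => by simp [Instance.misreport, hx]) hmis
    cases htruth : GDA next I s with
    | none => exact hc' (gdaState_final next hnext I s htruth ▸ Finset.mem_univ c')
    | some c =>
      have hinv := studentInvariant_gdaState next I
      rw [hmis, htruth, ← Report.certainlyPrefers_iff_measure_eq_one,
        hinv.assigned_eq_next s c htruth] at hprob
      exact (h s _ _ (hinv.rejected_ne_univ s c htruth)).2 c' hc' hprob

end IncentiveCompatibility

section RandomTieBreaking

variable {S C F T : Type*} [Fintype F] [MeasurableSpace T]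

theorem exists_measure_fiber_ne_zero {A : Type*} [Countable A] (ν : Measure T) [NeZero ν]
    (g : T → A) : ∃ a, ν (g ⁻¹' {a}) ≠ 0 := by
  refine (exists_measure_pos_of_not_measure_iUnion_null ?_).imp fun _ => ne_of_gt
  rw [← Set.preimage_iUnion, Set.iUnion_of_singleton, Set.preimage_univ]
  exact NeZero.ne _

/-- With positive probability both seeds lead to the same two outcomes as some fixed seed. -/
theorem iccRandom_of_forall_icc [Countable C] [DecidableEq S] (ν : Measure T)
    [IsProbabilityMeasure ν] {alg : T → Instance S C F → S → Option C}
    (hmeas : ∀ I s o, MeasurableSet {t | alg t I s = o}) (h : ∀ t, ICC (alg t)) :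
    ICCRandom ν alg := by
  intro I s r hprob
  obtain ⟨⟨o, o'⟩, hfiber⟩ :=
    exists_measure_fiber_ne_zero ν fun t => (alg t I s, alg t (I.misreport s r) s)
  set U := (fun t => (alg t I s, alg t (I.misreport s r) s)) ⁻¹' {(o, o')} with hU
  have hUmeas : MeasurableSet U := by
    convert (hmeas I s o).inter (hmeas (I.misreport s r) s o') using 1
    ext t
    simp [hU]
  obtain ⟨t₀, ht₀⟩ := nonempty_of_measure_ne_zero hfiber
  have hfixed := h t₀ I s r
  rw [(Prod.mk.inj ht₀).1, (Prod.mk.inj ht₀).2] at hfixed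
  set B := {w | (I.report s).Prefers w o' o}
  have hB : MeasurableSet B := (I.report s).measurableSet_prefers _ _
  have hevent : ((ν.prod ν).prod ((I.report s).μ : Measure (stdSimplex ℝ F)))
      ((U ×ˢ U) ×ˢ Bᶜ)ᶜ = 1 := by
    refine le_antisymm prob_le_one (hprob ▸ measure_mono ?_)
    rintro ⟨⟨t, t'⟩, w⟩ hp ⟨⟨ht, ht'⟩, hw⟩
    refine hw ?_
    have ho : alg t I s = o := (Prod.mk.inj ht).1
    have ho' : alg t' (I.misreport s r) s = o' := (Prod.mk.inj ht').2
    simpa only [Set.mem_ofPred_eq, ho, ho', B] using hp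
  rw [prob_compl_eq_one_iff ((hUmeas.prod hUmeas).prod hB.compl), Measure.prod_prod,
    Measure.prod_prod, mul_eq_zero, mul_self_eq_zero, prob_compl_eq_zero_iff hB] at hevent
  exact hevent.elim hfiber hfixed

theorem measurableSet_GDA_eq [Fintype S] [Fintype C] [DecidableEq C] {next : T → Rule S C F}
    (hmeas : ∀ s R r c, MeasurableSet {t | next t s R r = c}) (I : Instance S C F) (s : S)
    (o : Option C) : MeasurableSet {t | GDA (next t) I s = o} := by
  -- The outcome depends on the seed only through the finitely many values of the rule at `I`.
  let : MeasurableSpace C := ⊤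
  have hvalues : Measurable fun t s R => next t s R (I.report s) :=
    measurable_pi_iff.2 fun s => measurable_pi_iff.2 fun R =>
      measurable_to_countable' fun c => hmeas s R (I.report s) c
  exact hvalues (.of_discrete (s := {f : S → Finset C → C | GDA (fun s R _ => f s R) I s = o}))

end RandomTieBreaking

end SchoolChoice

theorem mainTheorem4_general {S C F T : Type*} [Fintype S] [DecidableEq S] [Fintype C]
    [DecidableEq C] [Fintype F] [MeasurableSpace T] :
    (∀ next : SchoolChoice.Rule S C F, SchoolChoice.IsSafe next →
      SchoolChoice.ICC (SchoolChoice.GDA next)) ∧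
    (∀ (ν : MeasureTheory.Measure T) [MeasureTheory.IsProbabilityMeasure ν]
      (next : T → SchoolChoice.Rule S C F),
      (∀ s R r c, MeasurableSet {t | next t s R r = c}) →
      (∀ t, SchoolChoice.IsSafe (next t)) →
      SchoolChoice.ICCRandom ν (fun t => SchoolChoice.GDA (next t))) :=
  ⟨fun _ h => h.icc, fun ν _ _ hmeas h =>
    SchoolChoice.iccRandom_of_forall_icc ν (SchoolChoice.measurableSet_GDA_eq hmeas)
      fun t => (h t).icc⟩

theorem mainTheorem4 {S C F T : Type*} [Fintype S] [DecidableEq S] [Fintype C] [DecidableEq C]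
    [Fintype F] [MeasurableSpace T] :
    -- predetermined tie-breaking
    (∀ next : SchoolChoice.Rule S C F,
      SchoolChoice.IsLOCV next ∨ SchoolChoice.IsLOICV next ∨
        SchoolChoice.IsHERF next ∨ SchoolChoice.IsHEUF next →
      SchoolChoice.ICC (SchoolChoice.GDA next)) ∧
    -- random tie-breaking, with seed `t` distributed according to `ν`
    (∀ (ν : MeasureTheory.Measure T) [MeasureTheory.IsProbabilityMeasure ν]
      (next : T → SchoolChoice.Rule S C F),
      (∀ s R r c, MeasurableSet {t | next t s R r = c}) →
      (∀ t, SchoolChoice.IsLOCV (next t)) ∨ (∀ t, SchoolChoice.IsLOICV (next t)) ∨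
        (∀ t, SchoolChoice.IsHERF (next t)) ∨ (∀ t, SchoolChoice.IsHEUF (next t)) →
      SchoolChoice.ICCRandom ν (fun t => SchoolChoice.GDA (next t))) := by
  refine ⟨fun next h => (mainTheorem4_general (T := T)).1 next ?_,
    fun ν _ next hmeas h => mainTheorem4_general.2 ν next hmeas ?_⟩
  · rcases h with h | h | h | h <;> exact h.isSafe
  · rcases h with h | h | h | h <;> exact fun t => (h t).isSafe
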